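/- Let $R$ be a commutative noetherian ring which is Cohen–Macaulay (i.e. $\operatorname{depth} R_{\mathfrak p}=\dim R_{\mathfrak p}$ for every prime $\mathfrak p$), and let $\omega$ be a canonical module of $R$, i.e. a finitely generated $R$-module such that for every prime $\mathfrak p$ the $R_{\mathfrak p}$-module $\omega_{\mathfrak p}$ is maximal Cohen–Macaulay, of finite injective dimension and of type one. Let $n\ge 0$ be an integer. All modules are finitely generated. Let $C$ be a semidualizing $R$-module: the homothety map $R\to\operatorname{Hom}_R(C,C)$ is an isomorphism and $\operatorname{Ext}^i_R(C,C)=0$ for all $i>0$. We use the following notions. * For $k\ge -1$, $R$ satisfies $(G_k^C)$ if $C_{\mathfrak p}$ has finite injective dimension over $R_{\mathfrak p}$ for every prime $\mathfrak p$ of height at most $k$. * $M$ satisfies $(S_n)$ if $\operatorname{depth} M_{\mathfrak p}\ge\min\{n,\dim R_{\mathfrak p}\}$ for every prime $\mathfrak p$ (with $\operatorname{depth} 0=\infty$); $S_n(R)$ is the class of such modules. * $M$ is an $n$-$C$-syzygy if there is an exact sequence $0\to M\to P_C^1\to P_C^2\to\cdots\to P_C^n$ in which each $P_C^i$ is a direct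 summand of a finite direct sum of copies of $C$ (for $n=0$ every module is one); $\Omega_C^n(\operatorname{mod} R)$ is the class of such modules. **Theorem 4.1.** The following conditions are equivalent: 1. $R$ satisfies $(G_{n-1}^C)$; 2. $S_n(R)=\Omega_C^n(\operatorname{mod} R)$; 3. $\omega\in\Omega_C^n(\operatorname{mod} R)$. In particular, for $C=R$: the ring $R_{\mathfrak p}$ is Gorenstein (i.e. of finite injective dimension over itself) for all primes $\mathfrak p$ of height less than $n$, if and only if $S_n(R)=\Omega_R^n(\operatorname{mod} R)$, if and only if $\omega\in\Omega_R^n(\operatorname{mod} R)$. -/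

import Mathlib

universe u

open CategoryTheory

/-- The depth of a module `M` over a local ring `A`: the supremum of the lengths of `M`-regular
sequences in the maximal ideal. For finitely generated `M ≠ 0` the requirement
`M ≠ (x₁, …, xᵣ) M` holds automatically (Nakayama); for `M = 0` every sequence is weakly regular,
which gives the usual convention `depth 0 = ∞`. -/
noncomputable def localDepth (A : Type u) [CommRing A] [IsLocalRing A]
    (M : Type u) [AddCommGroup M] [Module A M] : ℕ∞ :=
  ⨆ (rs : List A) (_ : ∀ r ∈ rs, r ∈ IsLocalRing.maximalIdeal A)
    (_ : RingTheory.Sequence.IsWeaklyRegular M rs), (rs.length : ℕ∞)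

/-- The module `M` has finite injective dimension over `A`. -/
def HasFiniteInjDim (A : Type u) [CommRing A] (M : Type u) [AddCommGroup M] [Module A M] : Prop :=
  ∃ m : ℕ, HasInjectiveDimensionLE (ModuleCat.of A M) m

/-- A (noetherian) ring is Cohen–Macaulay if `depth R_𝔭 = dim R_𝔭` for all prime ideals `𝔭`. -/
def IsCohenMacaulayRing (R : Type u) [CommRing R] : Prop :=
  ∀ p : PrimeSpectrum R,
    ((localDepth (Localization.AtPrime p.asIdeal) (Localization.AtPrime p.asIdeal) : ℕ∞) :
      WithBot ℕ∞) = ringKrullDim (Localization.AtPrime p.asIdeal)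

/-- Canonical modules of a (Cohen–Macaulay, noetherian) local ring `A` with residue field `k`:
finitely generated maximal Cohen–Macaulay modules of finite injective dimension and of type one,
the type of `W` being `dim_k Ext^t_A(k, W)` with `t = depth W`. -/
structure IsLocalCanonicalModule (A : Type u) [CommRing A] [IsLocalRing A]
    (W : Type u) [AddCommGroup W] [Module A W] : Prop where
  finite : Module.Finite A W
  maximalCohenMacaulay : ((localDepth A W : ℕ∞) : WithBot ℕ∞) = ringKrullDim A
  finiteInjDim : HasFiniteInjDim A W
  type_one : ∃ t : ℕ, localDepth A W = t ∧
    Nonempty (Abelian.Ext (ModuleCat.of A (IsLocalRing.ResidueField A)) (ModuleCat.of A W) t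
      ≃ₗ[A] IsLocalRing.ResidueField A)

/-- A canonical module of a (Cohen–Macaulay) ring `R`: a finitely generated module which is
locally a canonical module. -/
structure IsCanonicalModule (R : Type u) [CommRing R]
    (W : Type u) [AddCommGroup W] [Module R W] : Prop where
  finite : Module.Finite R W
  localCanonical : ∀ p : PrimeSpectrum R,
    IsLocalCanonicalModule (Localization.AtPrime p.asIdeal) (LocalizedModule p.asIdeal.primeCompl W)

/-- Semidualizing modules: finitely generated, the homothety map `R → Hom_R(C, C)` is an
isomorphism, and `Ext^i_R(C, C) = 0` for all `i > 0`. -/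
structure IsSemidualizing (R : Type u) [CommRing R]
    (C : Type u) [AddCommGroup C] [Module R C] : Prop where
  finite : Module.Finite R C
  homothety : Function.Bijective (LinearMap.lsmul R C : R →ₗ[R] C →ₗ[R] C)
  ext_vanishing : ∀ i : ℕ, 0 < i →
    Subsingleton (Abelian.Ext (ModuleCat.of R C) (ModuleCat.of R C) i)

/-- `P` is (isomorphic to) a direct summand of a finite direct sum of copies of `C`. -/
def IsSummandOfCopies (R : Type u) [CommRing R] (C : Type u) [AddCommGroup C] [Module R C]
    (P : Type u) [AddCommGroup P] [Module R P] : Prop :=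
  ∃ (k : ℕ) (i : P →ₗ[R] (Fin k → C)) (r : (Fin k → C) →ₗ[R] P), r ∘ₗ i = LinearMap.id

/-- `M` is an `n`-`C`-syzygy: there is an exact sequence `0 → M → P¹ → ⋯ → Pⁿ` with every `Pⁱ` a
direct summand of a finite direct sum of copies of `C`. Here `P 0` is `M` up to isomorphism, and
the terms `P i` with `i > n` play no role. There is no condition for `n = 0`. -/
def IsCSyzygy (R : Type u) [CommRing R] (C : Type u) [AddCommGroup C] [Module R C] (n : ℕ)
    (M : Type u) [AddCommGroup M] [Module R M] : Prop :=
  ∃ (P : ℕ → ModuleCat.{u} R) (d : ∀ i, P i →ₗ[R] P (i + 1)),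
    Nonempty (M ≃ₗ[R] P 0) ∧
    (∀ i, 1 ≤ i → i ≤ n → IsSummandOfCopies R C (P i)) ∧
    (1 ≤ n → Function.Injective (d 0)) ∧
    (∀ i, i + 1 < n → Function.Exact (d i) (d (i + 1)))

/-- The class `Ω^n_C(mod R)` of finitely generated `n`-`C`-syzygy modules. -/
def cSyzygyClass (R : Type u) [CommRing R] (C : Type u) [AddCommGroup C] [Module R C] (n : ℕ) :
    Set (ModuleCat.{u} R) :=
  {M | Module.Finite R M ∧ IsCSyzygy R C n M}

/-- Serre's condition `(S_n)`: `depth M_𝔭 ≥ min {n, dim R_𝔭}` for all prime ideals `𝔭`. -/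
def SatisfiesSerre (R : Type u) [CommRing R] (n : ℕ)
    (M : Type u) [AddCommGroup M] [Module R M] : Prop :=
  ∀ p : PrimeSpectrum R,
    min (n : WithBot ℕ∞) (ringKrullDim (Localization.AtPrime p.asIdeal)) ≤
      ((localDepth (Localization.AtPrime p.asIdeal) (LocalizedModule p.asIdeal.primeCompl M) : ℕ∞) :
        WithBot ℕ∞)

/-- The class `S_n(R)` of finitely generated modules satisfying `(S_n)`. -/
def serreClass (R : Type u) [CommRing R] (n : ℕ) : Set (ModuleCat.{u} R) :=
  {M | Module.Finite R M ∧ SatisfiesSerre R n M}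

/-- The condition `(G_k^C)`: `C_𝔭` has finite injective dimension over `R_𝔭` for all prime ideals
`𝔭` of height at most `k`. The index is an integer, so that `(G_{-1}^C)` is the empty condition.
(Heights are finite over a noetherian ring.) -/
def SatisfiesG (R : Type u) [CommRing R] (C : Type u) [AddCommGroup C] [Module R C] (k : ℤ) :
    Prop :=
  ∀ (p : PrimeSpectrum R) (h : ℕ), p.asIdeal.height = h → (h : ℤ) ≤ k →
    HasFiniteInjDim (Localization.AtPrime p.asIdeal) (LocalizedModule p.asIdeal.primeCompl C)

/-- A (noetherian) local ring is Gorenstein if it has finite injective dimension over itself. -/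
def IsGorensteinLocal (A : Type u) [CommRing A] : Prop :=
  HasFiniteInjDim A A

/- Let `N` be a nonzero finite module of finite injective dimension over a local ring `A` with
residue field `k`. Then `Ext^j(M, N) = 0` for `j > depth A - depth M`, while
`Ext^{depth A}(k, N) ≠ 0`. In particular a finite module without higher `Ext` into `N` has depth at
least `depth A`.

Let `C` satisfy `(G_{n-1}^C)`, let `M` satisfy `(S_n)`, and let `f : M → C^k` be a map through
which every map `M → C` factors. The kernel of `f` has depth `0` at its associated primes, which
have height `0`, but no maps to `C` there; so it vanishes. At a prime of height less than `n` the
cokernel `N` of `f` has no higher `Ext` into `C`, hence is maximal Cohen–Macaulay; so `N` satisfies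
`(S_{n-1})` and one iterates.

Conversely, let `0 → ω → P → N → 0` be exact with `P` in `add C` and `N` an `(n-1)`-`C`-syzygy. At a
prime `𝔭` of height less than `n` the module `N_𝔭` is maximal Cohen–Macaulay, so `Ext¹(N_𝔭, ω_𝔭)`
vanishes, the sequence splits and `ω_𝔭` lies in `add C_𝔭`. As `End C_𝔭 = R_𝔭` is local, `C_𝔭` is a
direct summand of `ω_𝔭`. -/

section Ext

variable {A : Type u} [CommRing A]
variable {X Y Z M N C P : Type u} [AddCommGroup X] [Module A X] [AddCommGroup Y] [Module A Y]
  [AddCommGroup Z] [Module A Z] [AddCommGroup M] [Module A M] [AddCommGroup N] [Module A N]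
  [AddCommGroup C] [Module A C] [AddCommGroup P] [Module A P]

/-- `Ext^i_A(M, N) = 0`. -/
abbrev ExtVanishes (A : Type u) [CommRing A] (M N : Type u) [AddCommGroup M] [Module A M]
    [AddCommGroup N] [Module A N] (i : ℕ) : Prop :=
  Subsingleton (Abelian.Ext (ModuleCat.of A M) (ModuleCat.of A N) i)

/-- Every map `X → C` extends along `f : X → Y`, that is, `Hom(f, C)` is surjective. When `Y` is a
direct summand of a finite direct sum of copies of `C`, this says that `f` is a left
`add C`-approximation of `X`. -/
def IsLeftApproximation {A : Type u} [CommRing A] (C : Type u) [AddCommGroup C] [Module A C]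
    {X Y : Type u} [AddCommGroup X] [Module A X] [AddCommGroup Y] [Module A Y]
    (f : X →ₗ[A] Y) : Prop :=
  ∀ φ : X →ₗ[A] C, ∃ ψ : Y →ₗ[A] C, ψ ∘ₗ f = φ

theorem extVanishes_zero_iff : ExtVanishes A M N 0 ↔ Subsingleton (M →ₗ[A] N) :=
  (Abelian.Ext.addEquiv₀.trans ModuleCat.homAddEquiv).subsingleton_congr

theorem extVanishes_of_projective [Module.Projective A M] {i : ℕ} (hi : 0 < i) :
    ExtVanishes A M N i := by
  obtain ⟨i, rfl⟩ := Nat.exists_eq_succ_of_ne_zero hi.ne'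
  have : Projective (ModuleCat.of A M) := (IsProjective.iff_projective _).mp inferInstance
  exact Abelian.Ext.subsingleton_of_projective _ _ i

theorem extVanishes_of_subsingleton [Subsingleton N] {i : ℕ} : ExtVanishes A M N i := by
  refine subsingleton_of_forall_eq 0 fun x => ?_
  have hid : 𝟙 (ModuleCat.of A N) = 0 := (ModuleCat.isZero_of_subsingleton _).eq_of_src _ _
  rw [← Abelian.Ext.comp_mk₀_id x, hid, Abelian.Ext.mk₀_zero, Abelian.Ext.comp_zero]

theorem ExtVanishes.zero_of_injective {f : X →ₗ[A] Y} (hf : Function.Injective f)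
    (h : ExtVanishes A M Y 0) : ExtVanishes A M X 0 := by
  rw [extVanishes_zero_iff] at h ⊢
  exact ⟨fun φ ψ => LinearMap.cancel_left hf |>.mp (Subsingleton.elim (f ∘ₗ φ) (f ∘ₗ ψ))⟩

section ShortExact

variable {f : X →ₗ[A] Y} {g : Y →ₗ[A] Z} (hf : Function.Injective f) (hfg : Function.Exact f g)
  (hg : Function.Surjective g)
include hf hfg hg

theorem moduleCatMk_shortExact :
    (ShortComplex.moduleCatMk f g hfg.linearMap_comp_eq_zero).ShortExact where
  exact := (ShortComplex.ShortExact.moduleCat_exact_iff_function_exact _).mpr hfg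
  mono_f := (ModuleCat.mono_iff_injective _).mpr hf
  epi_g := (ModuleCat.epi_iff_surjective _).mpr hg

theorem ExtVanishes.contravariant₁ {i : ℕ} (hY : ExtVanishes A Y N i)
    (hZ : ExtVanishes A Z N (i + 1)) : ExtVanishes A X N i := by
  refine subsingleton_of_forall_eq 0 fun x => ?_
  obtain ⟨y, rfl⟩ := Abelian.Ext.contravariant_sequence_exact₁ (moduleCatMk_shortExact hf hfg hg)
    _ x (add_comm 1 i) (Subsingleton.elim (h := hZ) _ _)
  obtain rfl : y = 0 := Subsingleton.elim (h := hY) _ _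
  exact Abelian.Ext.comp_zero ..

theorem ExtVanishes.contravariant₂ {i : ℕ} (hX : ExtVanishes A X N i)
    (hZ : ExtVanishes A Z N i) : ExtVanishes A Y N i := by
  refine subsingleton_of_forall_eq 0 fun x => ?_
  obtain ⟨y, rfl⟩ := Abelian.Ext.contravariant_sequence_exact₂ (moduleCatMk_shortExact hf hfg hg)
    _ x (Subsingleton.elim (h := hX) _ _)
  obtain rfl : y = 0 := Subsingleton.elim (h := hZ) _ _
  exact Abelian.Ext.comp_zero ..

theorem ExtVanishes.contravariant₃ {i : ℕ} (hX : ExtVanishes A X N i)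
    (hY : ExtVanishes A Y N (i + 1)) : ExtVanishes A Z N (i + 1) := by
  refine subsingleton_of_forall_eq 0 fun x => ?_
  obtain ⟨y, rfl⟩ := Abelian.Ext.contravariant_sequence_exact₃ (moduleCatMk_shortExact hf hfg hg)
    _ x (Subsingleton.elim (h := hY) _ _) (add_comm 1 i)
  obtain rfl : y = 0 := Subsingleton.elim (h := hX) _ _
  exact Abelian.Ext.comp_zero ..

theorem ExtVanishes.covariant₁ {i : ℕ} (hY : ExtVanishes A M Y (i + 1))
    (hZ : ExtVanishes A M Z i) : ExtVanishes A M X (i + 1) := by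
  refine subsingleton_of_forall_eq 0 fun x => ?_
  obtain ⟨y, rfl⟩ := Abelian.Ext.covariant_sequence_exact₁ _ (moduleCatMk_shortExact hf hfg hg)
    x (Subsingleton.elim (h := hY) _ _) rfl
  obtain rfl : y = 0 := Subsingleton.elim (h := hZ) _ _
  exact Abelian.Ext.zero_comp ..

theorem ExtVanishes.covariant₃ {i : ℕ} (hX : ExtVanishes A M X (i + 1))
    (hY : ExtVanishes A M Y i) : ExtVanishes A M Z i := by
  refine subsingleton_of_forall_eq 0 fun x => ?_
  obtain ⟨y, rfl⟩ := Abelian.Ext.covariant_sequence_exact₃ _ (moduleCatMk_shortExact hf hfg hg)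
    x rfl (Subsingleton.elim (h := hX) _ _)
  obtain rfl : y = 0 := Subsingleton.elim (h := hY) _ _
  exact Abelian.Ext.zero_comp ..

theorem ExtVanishes.exists_lift (h : ExtVanishes A M X 1) (φ : M →ₗ[A] Z) :
    ∃ ψ : M →ₗ[A] Y, g ∘ₗ ψ = φ := by
  obtain ⟨y, hy⟩ := Abelian.Ext.covariant_sequence_exact₃ (ModuleCat.of A M)
    (moduleCatMk_shortExact hf hfg hg) (Abelian.Ext.mk₀ (ModuleCat.ofHom φ)) (zero_add 1)
    (Subsingleton.elim (h := h) _ _)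
  obtain ⟨ψ, rfl⟩ := (Abelian.Ext.mk₀_bijective _ _).2 y
  rw [Abelian.Ext.mk₀_comp_mk₀] at hy
  exact ⟨ψ.hom, congrArg ModuleCat.Hom.hom ((Abelian.Ext.mk₀_bijective _ _).1 hy)⟩

theorem ExtVanishes.isLeftApproximation (h : ExtVanishes A Z N 1) : IsLeftApproximation N f := by
  intro φ
  obtain ⟨y, hy⟩ := Abelian.Ext.contravariant_sequence_exact₁ (moduleCatMk_shortExact hf hfg hg)
    (ModuleCat.of A N) (Abelian.Ext.mk₀ (ModuleCat.ofHom φ)) (add_comm 1 0)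
    (Subsingleton.elim (h := h) _ _)
  obtain ⟨ψ, rfl⟩ := (Abelian.Ext.mk₀_bijective _ _).2 y
  rw [Abelian.Ext.mk₀_comp_mk₀] at hy
  exact ⟨ψ.hom, congrArg ModuleCat.Hom.hom ((Abelian.Ext.mk₀_bijective _ _).1 hy)⟩

theorem IsLeftApproximation.extVanishes_one (h : IsLeftApproximation N f)
    (hY : ExtVanishes A Y N 1) : ExtVanishes A Z N 1 := by
  have hS := moduleCatMk_shortExact hf hfg hg
  refine subsingleton_of_forall_eq 0 fun x => ?_
  obtain ⟨y, rfl⟩ := Abelian.Ext.contravariant_sequence_exact₃ hS _ x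
    (Subsingleton.elim (h := hY) _ _) (add_comm 1 0)
  obtain ⟨φ, rfl⟩ := (Abelian.Ext.mk₀_bijective _ _).2 y
  obtain ⟨ψ, hψ⟩ := h φ.hom
  let ψ' : (ShortComplex.moduleCatMk f g hfg.linearMap_comp_eq_zero).X₂ ⟶ ModuleCat.of A N :=
    ModuleCat.ofHom ψ
  have hφ : φ = (ShortComplex.moduleCatMk f g hfg.linearMap_comp_eq_zero).f ≫ ψ' :=
    ModuleCat.hom_ext hψ.symm
  rw [hφ, ← Abelian.Ext.mk₀_comp_mk₀, ← Abelian.Ext.comp_assoc _ _ _ (add_zero 1) (zero_add 0)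
    (by simp), hS.extClass_comp, Abelian.Ext.zero_comp]
  rfl

end ShortExact

section SummandOfCopies

theorem isSummandOfCopies_iff_exists_sum : IsSummandOfCopies A C P ↔
    ∃ (k : ℕ) (s : Fin k → P →ₗ[A] C) (r : Fin k → C →ₗ[A] P),
      ∑ j, r j ∘ₗ s j = LinearMap.id := by
  constructor
  · rintro ⟨k, i, r, h⟩
    refine ⟨k, fun j => LinearMap.proj j ∘ₗ i, fun j => r ∘ₗ LinearMap.single A (fun _ => C) j, ?_⟩
    ext x
    simp only [LinearMap.sum_apply, LinearMap.comp_apply, LinearMap.proj_apply, ← map_sum,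
      LinearMap.coe_single, Finset.univ_sum_single]
    exact LinearMap.congr_fun h x
  · rintro ⟨k, s, r, h⟩
    refine ⟨k, LinearMap.pi s, LinearMap.lsum A (fun _ => C) A r, ?_⟩
    rw [← h]
    ext x
    simp [LinearMap.lsum_apply]

theorem IsSummandOfCopies.pi (k : ℕ) : IsSummandOfCopies A C (Fin k → C) :=
  ⟨k, LinearMap.id, LinearMap.id, rfl⟩

theorem IsSummandOfCopies.of_linearEquiv (e : P ≃ₗ[A] C) : IsSummandOfCopies A C P :=
  isSummandOfCopies_iff_exists_sum.mpr ⟨1, fun _ => e, fun _ => e.symm, by ext; simp⟩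

theorem IsSummandOfCopies.of_subsingleton [Subsingleton P] : IsSummandOfCopies A C P :=
  ⟨0, 0, 0, Subsingleton.elim _ _⟩

theorem IsSummandOfCopies.of_retract (hP : IsSummandOfCopies A C P) {i : M →ₗ[A] P}
    {r : P →ₗ[A] M} (h : r ∘ₗ i = LinearMap.id) : IsSummandOfCopies A C M := by
  obtain ⟨k, i', r', h'⟩ := hP
  refine ⟨k, i' ∘ₗ i, r ∘ₗ r', ?_⟩
  rw [LinearMap.comp_assoc, ← LinearMap.comp_assoc i, h', LinearMap.id_comp, h]

theorem IsSummandOfCopies.finite [Module.Finite A C] (hP : IsSummandOfCopies A C P) :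
    Module.Finite A P := by
  obtain ⟨k, i, r, h⟩ := hP
  exact Module.Finite.of_surjective r fun x => ⟨i x, LinearMap.congr_fun h x⟩

theorem ExtVanishes.of_isSummandOfCopies_left (hP : IsSummandOfCopies A C P) {i : ℕ}
    (h : ExtVanishes A C N i) : ExtVanishes A P N i := by
  obtain ⟨k, s, r, hsr⟩ := isSummandOfCopies_iff_exists_sum.mp hP
  refine subsingleton_of_forall_eq 0 fun x => ?_
  have hid : 𝟙 (ModuleCat.of A P) = ∑ j, ModuleCat.ofHom (s j) ≫ ModuleCat.ofHom (r j) := by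
    refine ModuleCat.hom_ext ?_
    simpa [ModuleCat.hom_sum] using hsr.symm
  rw [← Abelian.Ext.mk₀_id_comp x, hid, Abelian.Ext.mk₀_sum, Abelian.Ext.sum_comp]
  refine Finset.sum_eq_zero fun j _ => ?_
  rw [← Abelian.Ext.mk₀_comp_mk₀, Abelian.Ext.comp_assoc _ _ _ (zero_add 0) (zero_add i) (by simp),
    Subsingleton.elim ((Abelian.Ext.mk₀ (ModuleCat.ofHom (r j))).comp x (zero_add i)) 0,
    Abelian.Ext.comp_zero]

theorem ExtVanishes.of_isSummandOfCopies_right (hP : IsSummandOfCopies A C P) {i : ℕ}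
    (h : ExtVanishes A M C i) : ExtVanishes A M P i := by
  obtain ⟨k, s, r, hsr⟩ := isSummandOfCopies_iff_exists_sum.mp hP
  refine subsingleton_of_forall_eq 0 fun x => ?_
  have hid : 𝟙 (ModuleCat.of A P) = ∑ j, ModuleCat.ofHom (s j) ≫ ModuleCat.ofHom (r j) := by
    refine ModuleCat.hom_ext ?_
    simpa [ModuleCat.hom_sum] using hsr.symm
  rw [← Abelian.Ext.comp_mk₀_id x, hid, Abelian.Ext.mk₀_sum, Abelian.Ext.comp_sum]
  refine Finset.sum_eq_zero fun j _ => ?_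
  rw [← Abelian.Ext.mk₀_comp_mk₀, ← Abelian.Ext.comp_assoc _ _ _ (add_zero i) (zero_add 0)
    (by simp), Subsingleton.elim (x.comp (Abelian.Ext.mk₀ (ModuleCat.ofHom (s j))) (add_zero i)) 0,
    Abelian.Ext.zero_comp]

end SummandOfCopies

end Ext

section Depth

open IsLocalRing RingTheory.Sequence

variable {A : Type u} [CommRing A] [IsLocalRing A]
variable {X Y Z M : Type u} [AddCommGroup X] [Module A X] [AddCommGroup Y] [Module A Y]
  [AddCommGroup Z] [Module A Z] [AddCommGroup M] [Module A M]

theorem annihilator_residueField : Module.annihilator A (ResidueField A) = maximalIdeal A :=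
  Ideal.annihilator_quotient

theorem localDepth_eq_top [Subsingleton M] : localDepth A M = ⊤ := by
  refine ENat.eq_top_iff_forall_ge.mpr fun n => ?_
  have hreg : IsWeaklyRegular M (List.replicate n (0 : A)) :=
    ⟨fun _ _ _ _ _ => Subsingleton.elim _ _⟩
  have hmem : ∀ r ∈ List.replicate n (0 : A), r ∈ maximalIdeal A := fun r hr =>
    List.eq_of_mem_replicate hr ▸ zero_mem _
  exact le_iSup₂_of_le _ hmem (le_iSup_of_le hreg (by simp))

theorem natCast_le_localDepth_iff_exists_isWeaklyRegular {n : ℕ} :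
    (n : ℕ∞) ≤ localDepth A M ↔
      ∃ rs : List A, rs.length = n ∧ (∀ r ∈ rs, r ∈ maximalIdeal A) ∧ IsWeaklyRegular M rs := by
  constructor
  · intro h
    rcases n with _ | n
    · exact ⟨[], rfl, by simp, .nil A M⟩
    have hlt : (n : ℕ∞) < localDepth A M := lt_of_lt_of_le (by exact_mod_cast n.lt_succ_self) h
    simp only [localDepth, lt_iSup_iff, Nat.cast_lt] at hlt
    obtain ⟨rs, hmem, hreg, hlen⟩ := hlt
    refine ⟨rs.take (n + 1), by simpa using hlen, fun r hr => hmem r (List.mem_of_mem_take hr), ?_⟩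
    rw [← List.take_append_drop (n + 1) rs, isWeaklyRegular_append_iff] at hreg
    exact hreg.1
  · rintro ⟨rs, rfl, hmem, hreg⟩
    exact le_iSup₂_of_le rs hmem (le_iSup_of_le hreg le_rfl)

theorem exists_isSMulRegular_of_localDepth_ne_zero (h : localDepth A M ≠ 0) :
    ∃ x ∈ maximalIdeal A, IsSMulRegular M x := by
  have h1 : ((1 : ℕ) : ℕ∞) ≤ localDepth A M := by
    simpa using Order.one_le_iff_pos.mpr (pos_iff_ne_zero.mpr h)
  obtain ⟨rs, hlen, hmem, hreg⟩ := natCast_le_localDepth_iff_exists_isWeaklyRegular.mp h1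
  obtain ⟨x, rfl⟩ := List.length_eq_one_iff.mp hlen
  exact ⟨x, hmem x (by simp), ((isWeaklyRegular_cons_iff M x []).mp hreg).1⟩

theorem localDepth_quotSMulTop_add_one_le {x : A} (hx : x ∈ maximalIdeal A)
    (hreg : IsSMulRegular M x) : localDepth A (QuotSMulTop x M) + 1 ≤ localDepth A M := by
  refine ENat.forall_natCast_le_iff_le.mp fun n hn => ?_
  rcases n with _ | n
  · simp
  rw [Nat.cast_succ, ENat.add_le_add_iff_right ENat.one_ne_top,
    natCast_le_localDepth_iff_exists_isWeaklyRegular] at hn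
  obtain ⟨rs, rfl, hmem, hrs⟩ := hn
  exact natCast_le_localDepth_iff_exists_isWeaklyRegular.mpr ⟨x :: rs, rfl, by simpa using
    ⟨hx, hmem⟩, (isWeaklyRegular_cons_iff M x rs).mpr ⟨hreg, hrs⟩⟩

variable [IsNoetherianRing A]

theorem localDepth_self_le_ringKrullDim :
    ((localDepth A A : ℕ∞) : WithBot ℕ∞) ≤ ringKrullDim A := by
  obtain ⟨d, hd⟩ : ∃ d : ℕ∞, ((d : ℕ∞) : WithBot ℕ∞) = ringKrullDim A :=
    WithBot.ne_bot_iff_exists.mp ringKrullDim_ne_bot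
  rw [← hd, WithBot.coe_le_coe]
  refine iSup₂_le fun rs hmem => iSup_le fun hreg => ?_
  have hreg' := (isRegular_iff_isWeaklyRegular_of_subset_maximalIdeal hmem).mpr hreg
  have : Nontrivial (A ⧸ Ideal.ofList rs) := Ideal.Quotient.nontrivial_iff.mpr fun h =>
    hreg'.top_ne_smul (by simp [h])
  rw [← WithBot.coe_le_coe, hd, ← ringKrullDim_add_length_eq_ringKrullDim_of_isRegular rs hreg']
  exact le_add_of_nonneg_left ringKrullDim_nonneg_of_nontrivial

theorem localDepth_self_ne_top : localDepth A A ≠ ⊤ := by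
  intro h
  have := localDepth_self_le_ringKrullDim (A := A)
  rw [h] at this
  exact ringKrullDim_ne_top (top_le_iff.mp this)

theorem natCast_le_localDepth_iff_extVanishes [Module.Finite A M] {n : ℕ} :
    (n : ℕ∞) ≤ localDepth A M ↔ ∀ i < n, ExtVanishes A (ResidueField A) M i := by
  rcases subsingleton_or_nontrivial M with hM | hM
  · refine iff_of_true (by simp [localDepth_eq_top]) fun _ _ =>
      extVanishes_of_subsingleton
  have hlt : maximalIdeal A • (⊤ : Submodule A M) < ⊤ :=
    (Submodule.top_ne_ideal_smul_of_le_jacobson_annihilator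
      (maximalIdeal_le_jacobson _)).symm.lt_top
  have hsupp : Module.support A (ResidueField A) =
      PrimeSpectrum.zeroLocus (maximalIdeal A : Set A) := by
    rw [Module.support_eq_zeroLocus, annihilator_residueField]
  rw [natCast_le_localDepth_iff_exists_isWeaklyRegular]
  constructor
  · rintro ⟨rs, rfl, hmem, hreg⟩
    exact ModuleCat.subsingleton_ext_of_exists_isRegular (maximalIdeal A)
      (ModuleCat.of A (ResidueField A)) hsupp.subset (ModuleCat.of A M) hlt rs hmem
      ((isRegular_iff_isWeaklyRegular_of_subset_maximalIdeal hmem).mpr hreg)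
  · intro h
    obtain ⟨rs, hlen, hmem, hreg⟩ := ModuleCat.exists_isRegular_of_exists_subsingleton_ext
      (maximalIdeal A) n (ModuleCat.of A M) hlt (ModuleCat.of A (ResidueField A)) hsupp h
    exact ⟨rs, hlen, hmem, hreg.toIsWeaklyRegular⟩

theorem extVanishes_of_lt_localDepth [Module.Finite A M] {i : ℕ} (h : (i : ℕ∞) < localDepth A M) :
    ExtVanishes A (ResidueField A) M i :=
  natCast_le_localDepth_iff_extVanishes.mp
    (by exact_mod_cast Order.add_one_le_of_lt h : ((i + 1 : ℕ) : ℕ∞) ≤ _) i i.lt_succ_self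

theorem localDepth_eq_zero_iff_exists_injective [Module.Finite A M] :
    localDepth A M = 0 ↔ ∃ g : ResidueField A →ₗ[A] M, Function.Injective g := by
  have hsimple : IsSimpleModule A (ResidueField A) :=
    isSimpleModule_iff_quot_maximal.mpr ⟨maximalIdeal A, inferInstance, ⟨LinearEquiv.refl A _⟩⟩
  rw [← not_iff_not, ← ne_eq, ← Order.one_le_iff_ne_zero, ← Nat.cast_one,
    natCast_le_localDepth_iff_extVanishes]
  simp only [Nat.lt_one_iff, forall_eq, extVanishes_zero_iff]
  constructor
  · rintro h ⟨g, hg⟩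
    obtain ⟨x, hx⟩ := exists_ne (0 : ResidueField A)
    exact hx (hg (by rw [Subsingleton.elim g 0, LinearMap.zero_apply, LinearMap.zero_apply]))
  · intro h
    exact subsingleton_of_forall_eq 0 fun g => by_contra fun hg =>
      h ⟨g, LinearMap.injective_of_ne_zero hg⟩

theorem IsSummandOfCopies.localDepth_le [Module.Finite A M] (hX : IsSummandOfCopies A M X) :
    localDepth A M ≤ localDepth A X := by
  have := hX.finite
  refine ENat.forall_natCast_le_iff_le.mp fun n hn => ?_
  rw [natCast_le_localDepth_iff_extVanishes] at hn ⊢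
  exact fun i hi => .of_isSummandOfCopies_right hX (hn i hi)

section ShortExact

variable [Module.Finite A X] [Module.Finite A Y] [Module.Finite A Z]
  {f : X →ₗ[A] Y} {g : Y →ₗ[A] Z} (hf : Function.Injective f) (hfg : Function.Exact f g)
  (hg : Function.Surjective g)
include hf hfg hg

theorem min_localDepth_le_localDepth_left :
    min (localDepth A Y) (localDepth A Z + 1) ≤ localDepth A X := by
  refine ENat.forall_natCast_le_iff_le.mp fun n hn => ?_
  rw [le_min_iff] at hn
  refine natCast_le_localDepth_iff_extVanishes.mpr fun i hi => ?_
  have hY : ExtVanishes A (ResidueField A) Y i :=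
    natCast_le_localDepth_iff_extVanishes.mp hn.1 i hi
  rcases i with _ | i
  · exact hY.zero_of_injective hf
  · refine hY.covariant₁ hf hfg hg (extVanishes_of_lt_localDepth ?_)
    have : ((i + 1 : ℕ) : ℕ∞) < localDepth A Z + 1 := lt_of_lt_of_le (by exact_mod_cast hi) hn.2
    simpa using this

theorem min_localDepth_le_localDepth_right :
    min (localDepth A X) (localDepth A Y + 1) ≤ localDepth A Z + 1 := by
  refine ENat.forall_natCast_le_iff_le.mp fun n hn => ?_
  rw [le_min_iff] at hn
  rcases n with _ | n
  · simp
  have hY : (n : ℕ∞) ≤ localDepth A Y := by simpa using hn.2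
  rw [Nat.cast_succ, ENat.add_le_add_iff_right ENat.one_ne_top,
    natCast_le_localDepth_iff_extVanishes]
  exact fun i hi => .covariant₃ hf hfg hg
    (natCast_le_localDepth_iff_extVanishes.mp hn.1 (i + 1) (by omega))
    (natCast_le_localDepth_iff_extVanishes.mp hY i hi)

end ShortExact

theorem localDepth_quotSMulTop_add_one [Module.Finite A M] {x : A} (hx : x ∈ maximalIdeal A)
    (hreg : IsSMulRegular M x) : localDepth A (QuotSMulTop x M) + 1 = localDepth A M := by
  refine (localDepth_quotSMulTop_add_one_le hx hreg).antisymm ?_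
  have h := min_localDepth_le_localDepth_right (f := LinearMap.lsmul A M x) hreg
    (LinearMap.exact_lsmul_mkQ_smul_top M x) (Submodule.mkQ_surjective _)
  rwa [min_eq_left le_self_add] at h

end Depth

section InjectiveDimension

open IsLocalRing

variable {A : Type u} [CommRing A]
variable {M N C W : Type u} [AddCommGroup M] [Module A M] [AddCommGroup N] [Module A N]
  [AddCommGroup C] [Module A C] [AddCommGroup W] [Module A W]

theorem HasFiniteInjDim.of_retract (hW : HasFiniteInjDim A W) {i : C →ₗ[A] W} {r : W →ₗ[A] C}
    (h : r ∘ₗ i = LinearMap.id) : HasFiniteInjDim A C := by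
  obtain ⟨m, hm⟩ := hW
  let ρ : Retract (ModuleCat.of A C) (ModuleCat.of A W) :=
    ⟨ModuleCat.ofHom i, ModuleCat.ofHom r, ModuleCat.hom_ext h⟩
  exact ⟨m, ρ.hasInjectiveDimensionLT (m + 1)⟩

/-- `Ext^j_A(X, N) = 0` for all finitely generated modules `X`. Over a noetherian local ring this
says that the injective dimension of `N` is less than `j`. -/
def FiniteExtVanishes (A : Type u) [CommRing A] (N : Type u) [AddCommGroup N] [Module A N]
    (j : ℕ) : Prop :=
  ∀ (X : Type u) [AddCommGroup X] [Module A X] [Module.Finite A X], ExtVanishes A X N j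

theorem ExtVanishes.quotSMulTop_left {x : A} (hreg : IsSMulRegular M x) {i : ℕ}
    (h : ExtVanishes A M N i) (h' : ExtVanishes A M N (i + 1)) :
    ExtVanishes A (QuotSMulTop x M) N (i + 1) :=
  .contravariant₃ (f := LinearMap.lsmul A M x) hreg (LinearMap.exact_lsmul_mkQ_smul_top M x)
    (Submodule.mkQ_surjective _) h h'

theorem ExtVanishes.quotSMulTop_right {x : A} (hreg : IsSMulRegular N x) {i : ℕ}
    (h : ExtVanishes A M N i) (h' : ExtVanishes A M N (i + 1)) :
    ExtVanishes A M (QuotSMulTop x N) i :=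
  .covariant₃ (f := LinearMap.lsmul A N x) hreg (LinearMap.exact_lsmul_mkQ_smul_top N x)
    (Submodule.mkQ_surjective _) h' h

variable [IsNoetherianRing A]

theorem ExtVanishes.of_quotSMulTop_left [Module.Finite A M] [Module.Finite A N] {x : A}
    (hx : x ∈ (⊥ : Ideal A).jacobson) (hreg : IsSMulRegular M x) {i : ℕ}
    (h : ExtVanishes A (QuotSMulTop x M) N (i + 1)) : ExtVanishes A M N i := by
  have hS : ((ModuleCat.of A M).smulShortComplex x).ShortExact :=
    IsSMulRegular.smulShortComplex_shortExact (M := ModuleCat.of A M) hreg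
  have hfin : Module.Finite A (Abelian.Ext (ModuleCat.of A M) (ModuleCat.of A N) i) :=
    ModuleCat.finite_ext A (ModuleCat.of A M) (ModuleCat.of A N) i
  have htop : (⊤ : Submodule A (Abelian.Ext (ModuleCat.of A M) (ModuleCat.of A N) i)) = ⊥ := by
    refine Submodule.eq_bot_of_le_smul_of_le_jacobson_bot _ _ hfin.fg_top (fun y _ => ?_) le_rfl
    obtain ⟨z, rfl⟩ := Abelian.Ext.contravariant_sequence_exact₁ hS _ y (add_comm 1 i)
      (Subsingleton.elim (h := h) _ _)
    have hz (z : Abelian.Ext (ModuleCat.of A M) (ModuleCat.of A N) i) :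
        (Abelian.Ext.mk₀ (x • 𝟙 (ModuleCat.of A M))).comp z (zero_add i) = x • z := by
      rw [Abelian.Ext.mk₀_smul, Abelian.Ext.smul_comp, Abelian.Ext.mk₀_id_comp]
    exact (hz z).symm ▸ Submodule.smul_mem_smul hx trivial
  exact (Submodule.subsingleton_iff A).mp (subsingleton_of_bot_eq_top htop.symm)

variable [IsLocalRing A]

theorem FiniteExtVanishes.extVanishes_residueField [Module.Finite A M] {t j : ℕ}
    (hN : FiniteExtVanishes A N (j + t + 1)) (ht : localDepth A M = t)
    (hM : ∀ i, j ≤ i → ExtVanishes A M N i) : ExtVanishes A (ResidueField A) N (j + t) := by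
  induction t generalizing M j with
  | zero =>
    obtain ⟨g, hg⟩ := localDepth_eq_zero_iff_exists_injective.mp ht
    exact .contravariant₁ hg (LinearMap.exact_map_mkQ_range g) (Submodule.mkQ_surjective _)
      (hM j le_rfl) (hN _)
  | succ t ih =>
    obtain ⟨x, hx, hreg⟩ := exists_isSMulRegular_of_localDepth_ne_zero (A := A) (M := M)
      (by simp [ht])
    have ht' : localDepth A (QuotSMulTop x M) = t :=
      ENat.add_left_injective_of_ne_top ENat.one_ne_top <| by
        simpa only [localDepth_quotSMulTop_add_one hx hreg, Nat.cast_succ] using ht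
    rw [add_comm t, ← add_assoc] at hN ⊢
    refine ih hN ht' fun i hi => ?_
    obtain ⟨i, rfl⟩ := Nat.exists_eq_add_of_le' hi
    exact (hM (i + j) (by omega)).quotSMulTop_left hreg (hM (i + j + 1) (by omega))

variable [Module.Finite A N]

theorem FiniteExtVanishes.extVanishes_of_le_localDepth [Module.Finite A M] {t j : ℕ}
    (hN : FiniteExtVanishes A N (j + t)) (ht : t ≤ localDepth A M) : ExtVanishes A M N j := by
  induction t generalizing M j with
  | zero => exact hN M
  | succ t ih =>
    obtain ⟨x, hx, hreg⟩ := exists_isSMulRegular_of_localDepth_ne_zero (A := A) (M := M)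
      (by rintro h; simp [h] at ht)
    rw [← localDepth_quotSMulTop_add_one hx hreg, Nat.cast_succ,
      ENat.add_le_add_iff_right ENat.one_ne_top] at ht
    rw [add_comm t, ← add_assoc] at hN
    exact .of_quotSMulTop_left (maximalIdeal_le_jacobson _ hx) hreg (ih hN ht)

theorem FiniteExtVanishes.of_residueField {j : ℕ} (hN : FiniteExtVanishes A N (j + 1))
    (hk : ExtVanishes A (ResidueField A) N j) : FiniteExtVanishes A N j := by
  intro X _ _ hX
  induction hX using IsNoetherianRing.induction_on_isQuotientEquivQuotientPrime A with
  | subsingleton X => exact hk.of_isSummandOfCopies_left .of_subsingleton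
  | quotient X p e =>
    refine ExtVanishes.of_isSummandOfCopies_left (.of_linearEquiv e) ?_
    by_cases hp : p.asIdeal = maximalIdeal A
    · rwa [hp]
    obtain ⟨x, hx, hxp⟩ := SetLike.exists_of_lt
      (lt_of_le_of_ne (le_maximalIdeal p.isPrime.ne_top) hp)
    refine .of_quotSMulTop_left (maximalIdeal_le_jacobson _ hx) ?_
      (hN (QuotSMulTop x (A ⧸ p.asIdeal)))
    rw [isSMulRegular_iff_right_eq_zero_of_smul]
    intro y hy
    have hxy : Ideal.Quotient.mk p.asIdeal x * y = 0 := (Algebra.smul_def x y).symm.trans hy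
    exact (mul_eq_zero.mp hxy).resolve_left (Ideal.Quotient.eq_zero_iff_mem.not.mpr hxp)
  | exact X Y Z f g hf hg hfg hX hZ => exact hX.contravariant₂ hf hfg hg hZ

namespace HasFiniteInjDim

theorem finiteExtVanishes (hN : HasFiniteInjDim A N) {j : ℕ} (hj : localDepth A A < j) :
    FiniteExtVanishes A N j := by
  obtain ⟨m, hm⟩ := hN
  obtain ⟨d, hd⟩ := ENat.ne_top_iff_exists.mp (localDepth_self_ne_top (A := A))
  have hdj : d < j := by rw [← hd] at hj; exact_mod_cast hj
  refine Nat.decreasingInduction' (m := j) (n := j + m + 1) (fun i _ hji hi => ?_) (by omega)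
    fun X _ _ _ => HasInjectiveDimensionLT.subsingleton (ModuleCat.of A N) (m + 1) _ (by omega) _
  obtain ⟨e, rfl⟩ := Nat.exists_eq_add_of_le' (show d ≤ i by omega)
  exact hi.of_residueField <| hi.extVanishes_residueField hd.symm fun l hl =>
    extVanishes_of_projective (by omega)

theorem extVanishes_of_pos (hN : HasFiniteInjDim A N) [Module.Finite A M]
    (hM : localDepth A A ≤ localDepth A M) {j : ℕ} (hj : 0 < j) : ExtVanishes A M N j := by
  obtain ⟨d, hd⟩ := ENat.ne_top_iff_exists.mp (localDepth_self_ne_top (A := A))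
  refine (hN.finiteExtVanishes ?_).extVanishes_of_le_localDepth (hd.trans_le hM)
  rw [← hd]
  exact_mod_cast Nat.lt_add_of_pos_left hj

theorem not_extVanishes_residueField (hN : HasFiniteInjDim A N) [Nontrivial N] {d : ℕ}
    (hd : localDepth A A = d) : ¬ExtVanishes A (ResidueField A) N d := by
  intro h
  have hN' : FiniteExtVanishes A N d :=
    (hN.finiteExtVanishes (by rw [hd]; exact_mod_cast d.lt_succ_self)).of_residueField h
  rw [← zero_add d] at hN'
  have hAN := hN'.extVanishes_of_le_localDepth hd.ge
  rw [extVanishes_zero_iff] at hAN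
  exact not_subsingleton N (LinearMap.ringLmapEquivSelf A A N).symm.toEquiv.subsingleton

theorem localDepth_self_le (hN : HasFiniteInjDim A N) [Nontrivial N] [Module.Finite A M]
    (hM : ∀ i, 0 < i → ExtVanishes A M N i) : localDepth A A ≤ localDepth A M := by
  by_contra! hlt
  obtain ⟨t, ht⟩ := ENat.ne_top_iff_exists.mp hlt.ne_top
  obtain ⟨d, hd⟩ := ENat.ne_top_iff_exists.mp (localDepth_self_ne_top (A := A))
  obtain ⟨e, rfl⟩ : ∃ e, d = e + 1 + t := by
    rw [← ht, ← hd, Nat.cast_lt] at hlt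
    exact ⟨d - (t + 1), by omega⟩
  refine hN.not_extVanishes_residueField hd.symm <|
    (hN.finiteExtVanishes ?_).extVanishes_residueField ht.symm fun i hi => hM i (by omega)
  rw [← hd]
  exact_mod_cast Nat.lt_succ_self _

theorem localDepth_le (hN : HasFiniteInjDim A N) [Nontrivial N] :
    localDepth A N ≤ localDepth A A := by
  obtain ⟨d, hd⟩ := ENat.ne_top_iff_exists.mp (localDepth_self_ne_top (A := A))
  rw [← hd]
  by_contra! hlt
  exact hN.not_extVanishes_residueField hd.symm (extVanishes_of_lt_localDepth hlt)

end HasFiniteInjDim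

end InjectiveDimension

section Semidualizing

open IsLocalRing RingTheory.Sequence
open scoped Pointwise

section Ring

variable {A : Type u} [CommRing A]
variable {C N : Type u} [AddCommGroup C] [Module A C] [AddCommGroup N] [Module A N]

theorem nonempty_quotSMulTop_linearMap_equiv {x : A} (hx : IsSMulRegular N x)
    (h : ExtVanishes A C N 1) :
    Nonempty (QuotSMulTop x (C →ₗ[A] N) ≃ₗ[A] (C →ₗ[A] QuotSMulTop x N)) := by
  let q : N →ₗ[A] QuotSMulTop x N := Submodule.mkQ _
  have hxq : Function.Exact (LinearMap.lsmul A N x) q := LinearMap.exact_lsmul_mkQ_smul_top N x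
  have hq : Function.Surjective (LinearMap.compRight A (M := C) q) :=
    h.exists_lift (f := LinearMap.lsmul A N x) hx hxq (Submodule.mkQ_surjective _)
  have hker : x • (⊤ : Submodule A (C →ₗ[A] N)) = LinearMap.ker (LinearMap.compRight A q) := by
    ext φ
    rw [Submodule.mem_smul_pointwise_iff_exists, LinearMap.mem_ker]
    constructor
    · rintro ⟨ψ, -, rfl⟩
      ext c
      exact (hxq _).mpr ⟨ψ c, rfl⟩
    · intro hφ
      have hrange (c : C) : φ c ∈ LinearMap.range (LinearMap.lsmul A N x) :=
        (hxq (φ c)).mp (LinearMap.congr_fun hφ c)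
      let e := LinearEquiv.ofInjective (LinearMap.lsmul A N x) hx
      refine ⟨e.symm.toLinearMap ∘ₗ φ.codRestrict _ hrange, trivial, ?_⟩
      ext c
      exact congrArg Subtype.val (e.apply_symm_apply ⟨φ c, hrange c⟩)
  exact ⟨(Submodule.quotEquivOfEq _ _ hker).trans
    ((LinearMap.compRight A q).quotKerEquivOfSurjective hq)⟩

theorem isSemidualizing_self : IsSemidualizing A A where
  finite := inferInstance
  homothety := by
    refine ⟨fun a b h => ?_, fun f => ⟨f 1, ?_⟩⟩
    · simpa using LinearMap.congr_fun h 1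
    · ext
      simp
  ext_vanishing _ hi := extVanishes_of_projective hi

theorem IsSemidualizing.annihilator_eq_bot (hC : IsSemidualizing A C) :
    Module.annihilator A C = ⊥ := by
  refine (Submodule.eq_bot_iff _).mpr fun r hr => hC.homothety.1 ?_
  ext c
  simpa using Module.mem_annihilator.mp hr c

theorem IsSemidualizing.nontrivial [Nontrivial A] (hC : IsSemidualizing A C) : Nontrivial C := by
  rw [← not_subsingleton_iff_nontrivial, ← Module.annihilator_eq_top_iff (R := A),
    hC.annihilator_eq_bot]
  exact bot_ne_top

section Noetherian

variable [IsNoetherianRing A] [Module.Finite A C] [Module.Finite A N]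

theorem isSMulRegular_of_linearMap (hC : Module.annihilator A C = ⊥) {x : A}
    (hx : IsSMulRegular (C →ₗ[A] N) x) : IsSMulRegular N x := by
  have hHom : Subsingleton (C →ₗ[A] LinearMap.ker (LinearMap.lsmul A N x)) := by
    refine subsingleton_of_forall_eq 0 fun φ => ?_
    have hφ : (LinearMap.ker (LinearMap.lsmul A N x)).subtype ∘ₗ φ = 0 := by
      refine hx ?_
      ext c
      exact (LinearMap.mem_ker.mp (φ c).2).trans (smul_zero x).symm
    ext c
    simpa using LinearMap.congr_fun hφ c
  obtain ⟨r, hr, hreg⟩ := IsSMulRegular.subsingleton_linearMap_iff.mp hHom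
  obtain rfl : r = 0 := by rwa [hC, Ideal.mem_bot] at hr
  rw [isSMulRegular_iff_right_eq_zero_of_smul]
  intro y hy
  have hker : (⟨y, hy⟩ : LinearMap.ker (LinearMap.lsmul A N x)) = 0 := hreg (by simp)
  exact congrArg Subtype.val hker

theorem isWeaklyRegular_of_linearMap (hC : Module.annihilator A C = ⊥)
    (hN : ∀ i, 0 < i → ExtVanishes A C N i) {rs : List A}
    (h : IsWeaklyRegular (C →ₗ[A] N) rs) : IsWeaklyRegular N rs := by
  induction rs generalizing N with
  | nil => exact .nil A N
  | cons x rs ih =>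
    rw [isWeaklyRegular_cons_iff] at h ⊢
    have hx := isSMulRegular_of_linearMap hC h.1
    obtain ⟨e⟩ := nonempty_quotSMulTop_linearMap_equiv hx (hN 1 one_pos)
    exact ⟨hx, ih (fun i hi => (hN i hi).quotSMulTop_right hx (hN _ i.succ_pos))
      ((e.isWeaklyRegular_congr rs).mp h.2)⟩

end Noetherian

end Ring

section LocalRing

variable {A : Type u} [CommRing A] [IsLocalRing A]
variable {C K M N P W : Type u} [AddCommGroup C] [Module A C] [AddCommGroup K] [Module A K]
  [AddCommGroup M] [Module A M] [AddCommGroup N] [Module A N] [AddCommGroup P] [Module A P]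
  [AddCommGroup W] [Module A W]

theorem IsSemidualizing.localDepth_self_le [IsNoetherianRing A] (hC : IsSemidualizing A C) :
    localDepth A A ≤ localDepth A C := by
  have := hC.finite
  refine iSup_mono fun rs => iSup_mono fun _ => iSup_mono' fun hrs => ⟨?_, le_rfl⟩
  exact isWeaklyRegular_of_linearMap hC.annihilator_eq_bot hC.ext_vanishing
    (((LinearEquiv.ofBijective _ hC.homothety).isWeaklyRegular_congr rs).mp hrs)

theorem eq_zero_of_forall_eq_sum_smul {ι : Type*} [Fintype ι] {v : ι → M} {a : ι → ι → A}
    (ha : ∀ i j, a i j ∈ maximalIdeal A) (hv : ∀ i, v i = ∑ j, a i j • v j) (i : ι) : v i = 0 := by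
  have hspan : Submodule.span A (Set.range v) = ⊥ := by
    refine Submodule.eq_bot_of_le_smul_of_le_jacobson_bot (maximalIdeal A) _
      (Submodule.fg_span (Set.finite_range v)) ?_ (maximalIdeal_le_jacobson _)
    rw [Submodule.span_le]
    rintro _ ⟨i, rfl⟩
    rw [hv]
    exact Submodule.sum_mem _ fun j _ =>
      Submodule.smul_mem_smul (ha i j) (Submodule.subset_span ⟨j, rfl⟩)
  exact (Submodule.mem_bot A).mp (hspan ▸ Submodule.subset_span ⟨i, rfl⟩)

theorem IsSummandOfCopies.exists_retract (hC : Function.Surjective (LinearMap.lsmul A C))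
    [Nontrivial W] (hW : IsSummandOfCopies A C W) :
    ∃ (i : C →ₗ[A] W) (r : W →ₗ[A] C), r ∘ₗ i = LinearMap.id := by
  obtain ⟨k, s, r, hsr⟩ := isSummandOfCopies_iff_exists_sum.mp hW
  choose a ha using fun l j => hC (s l ∘ₗ r j)
  by_cases hu : ∃ l j, IsUnit (a l j)
  · obtain ⟨l, j, u, hu⟩ := hu
    refine ⟨((u⁻¹ : Aˣ) : A) • r j, s l, ?_⟩
    rw [LinearMap.comp_smul, ← ha, ← hu]
    ext c
    simp [smul_smul]
  · push Not at hu
    have hs : ∀ l, s l = 0 := by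
      refine eq_zero_of_forall_eq_sum_smul hu fun l => ?_
      ext w
      calc s l w = s l ((∑ j, r j ∘ₗ s j) w) := by rw [hsr, LinearMap.id_apply]
        _ = ∑ j, (s l ∘ₗ r j) (s j w) := by simp [LinearMap.sum_apply]
        _ = (∑ j, a l j • s j) w := by simp [← ha, LinearMap.sum_apply]
    obtain ⟨w, hw⟩ := exists_ne (0 : W)
    exact absurd (LinearMap.congr_fun hsr w).symm (by simpa [hs] using hw)

variable [IsNoetherianRing A]

namespace HasFiniteInjDim

theorem of_exact (hC : Function.Surjective (LinearMap.lsmul A C)) (hW : HasFiniteInjDim A W)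
    [Module.Finite A W] [Nontrivial W] [Module.Finite A N] {f : W →ₗ[A] P} {g : P →ₗ[A] N}
    (hf : Function.Injective f) (hfg : Function.Exact f g) (hg : Function.Surjective g)
    (hP : IsSummandOfCopies A C P) (hN : localDepth A A ≤ localDepth A N) :
    HasFiniteInjDim A C := by
  obtain ⟨r, hr⟩ : ∃ r : P →ₗ[A] W, r ∘ₗ f = LinearMap.id :=
    (hW.extVanishes_of_pos hN one_pos).isLeftApproximation hf hfg hg LinearMap.id
  obtain ⟨i, q, hqi⟩ := (hP.of_retract hr).exists_retract hC
  exact hW.of_retract hqi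

theorem localDepth_self_le_of_exact (hC : HasFiniteInjDim A C) (hC' : IsSemidualizing A C)
    [Module.Finite A M] [Module.Finite A N] {f : M →ₗ[A] P} {g : P →ₗ[A] N}
    (hf : Function.Injective f) (hfg : Function.Exact f g) (hg : Function.Surjective g)
    (hfC : IsLeftApproximation C f) (hP : IsSummandOfCopies A C P)
    (hM : localDepth A A ≤ localDepth A M) : localDepth A A ≤ localDepth A N := by
  have := hC'.finite
  have := hC'.nontrivial
  have hPC {i : ℕ} (hi : 0 < i) : ExtVanishes A P C i :=
    .of_isSummandOfCopies_left hP (hC'.ext_vanishing i hi)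
  refine hC.localDepth_self_le fun i hi => ?_
  obtain _ | _ | i := i
  · exact absurd hi (lt_irrefl 0)
  · exact hfC.extVanishes_one hf hfg hg (hPC one_pos)
  · exact .contravariant₃ hf hfg hg (hC.extVanishes_of_pos hM i.succ_pos) (hPC (by omega))

theorem localDepth_ne_zero_of_comp_eq_zero (hC : HasFiniteInjDim A C) [Module.Finite A C]
    [Nontrivial C] (hA : localDepth A A = 0) [Module.Finite A K] [Module.Finite A M]
    {ι : K →ₗ[A] M} {f : M →ₗ[A] P} (hι : Function.Injective ι) (hfι : f ∘ₗ ι = 0)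
    (hf : IsLeftApproximation C f) : localDepth A K ≠ 0 := by
  have hExt (X : Type u) [AddCommGroup X] [Module A X] [Module.Finite A X] :
      ExtVanishes A X C 1 := hC.extVanishes_of_pos (by simp [hA]) one_pos
  have hKC : ExtVanishes A K C 0 := by
    rw [extVanishes_zero_iff]
    refine subsingleton_of_forall_eq 0 fun φ => ?_
    obtain ⟨ψ, rfl⟩ := (hExt _).isLeftApproximation hι (LinearMap.exact_map_mkQ_range ι)
      (Submodule.mkQ_surjective _) φ
    obtain ⟨χ, rfl⟩ := hf ψ
    rw [LinearMap.comp_assoc, hfι, LinearMap.comp_zero]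
  intro hK
  obtain ⟨g, hg⟩ := localDepth_eq_zero_iff_exists_injective.mp hK
  exact hC.not_extVanishes_residueField hA <| hKC.contravariant₁ hg
    (LinearMap.exact_map_mkQ_range g) (Submodule.mkQ_surjective _) (hExt _)

end HasFiniteInjDim

end LocalRing

end Semidualizing

section Localization

variable {R : Type u} [CommRing R] (S : Submonoid R)

theorem localizedModule_map_comp {X Y Z : Type*} [AddCommGroup X] [Module R X] [AddCommGroup Y]
    [Module R Y] [AddCommGroup Z] [Module R Z] (f : X →ₗ[R] Y) (g : Y →ₗ[R] Z) :
    LocalizedModule.map S (g ∘ₗ f) = LocalizedModule.map S g ∘ₗ LocalizedModule.map S f := by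
  ext x
  induction x using LocalizedModule.induction_on with
  | h m s => simp

theorem exact_localizedModule_map {X Y Z : Type*} [AddCommGroup X] [Module R X] [AddCommGroup Y]
    [Module R Y] [AddCommGroup Z] [Module R Z] {f : X →ₗ[R] Y} {g : Y →ₗ[R] Z}
    (hfg : Function.Exact f g) :
    Function.Exact (LocalizedModule.map S f) (LocalizedModule.map S g) :=
  LocalizedModule.map_exact S f g hfg

variable {C M N P : Type u} [AddCommGroup C] [Module R C] [AddCommGroup M] [Module R M]
  [AddCommGroup N] [Module R N] [AddCommGroup P] [Module R P]

theorem IsSummandOfCopies.localizedModule (hP : IsSummandOfCopies R C P) :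
    IsSummandOfCopies (Localization S) (LocalizedModule S C) (LocalizedModule S P) := by
  obtain ⟨k, s, r, hsr⟩ := isSummandOfCopies_iff_exists_sum.mp hP
  refine isSummandOfCopies_iff_exists_sum.mpr
    ⟨k, fun j => LocalizedModule.map S (s j), fun j => LocalizedModule.map S (r j), ?_⟩
  simp only [← localizedModule_map_comp]
  rw [← map_sum, hsr, LocalizedModule.map_id]

theorem IsLeftApproximation.localizedModule [Module.FinitePresentation R M] {f : M →ₗ[R] P}
    (hf : IsLeftApproximation C f) :
    IsLeftApproximation (LocalizedModule S C) (LocalizedModule.map S f) := by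
  intro φ
  obtain ⟨⟨φ₀, s⟩, hφ⟩ := IsLocalizedModule.surj S (LocalizedModule.map S (M := M) (N := C)) φ
  obtain ⟨ψ₀, rfl⟩ := hf φ₀
  refine ⟨Localization.mk 1 s • LocalizedModule.map S ψ₀, ?_⟩
  rw [LinearMap.smul_comp, ← localizedModule_map_comp, ← hφ, Submonoid.smul_def,
    ← IsScalarTower.algebraMap_smul (Localization S) (s : R) φ, smul_smul,
    ← Localization.mk_one_eq_algebraMap, Localization.mk_mul, one_mul, mul_one,
    Localization.mk_self, one_smul]

variable [IsNoetherianRing R]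

theorem ExtVanishes.localizedModule [Module.Finite R M] {i : ℕ} (hi : 0 < i)
    (h : ExtVanishes R M N i) :
    ExtVanishes (Localization S) (LocalizedModule S M) (LocalizedModule S N) i := by
  obtain ⟨i, rfl⟩ := Nat.exists_eq_add_of_le' hi
  induction i generalizing M with
  | zero =>
    obtain ⟨n, g, hg⟩ := Module.Finite.exists_fin' R M
    have hf : Function.Injective (LinearMap.ker g).subtype := Subtype.val_injective
    have hfg : Function.Exact (LinearMap.ker g).subtype g := LinearMap.exact_subtype_ker_map g
    have := Module.finitePresentation_of_finite R (LinearMap.ker g)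
    exact ((h.isLeftApproximation hf hfg hg).localizedModule S).extVanishes_one
      (LocalizedModule.map_injective S _ hf) (exact_localizedModule_map S hfg)
      (LocalizedModule.map_surjective S g hg) (extVanishes_of_projective one_pos)
  | succ i ih =>
    obtain ⟨n, g, hg⟩ := Module.Finite.exists_fin' R M
    have hf : Function.Injective (LinearMap.ker g).subtype := Subtype.val_injective
    have hfg : Function.Exact (LinearMap.ker g).subtype g := LinearMap.exact_subtype_ker_map g
    have hker : ExtVanishes R (LinearMap.ker g) N (i + 1) :=
      .contravariant₁ hf hfg hg (extVanishes_of_projective i.succ_pos) h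
    exact (ih i.succ_pos hker).contravariant₃ (LocalizedModule.map_injective S _ hf)
      (exact_localizedModule_map S hfg) (LocalizedModule.map_surjective S g hg)
      (extVanishes_of_projective (Nat.succ_pos _))

theorem bijective_lsmul_localizedModule [Module.Finite R C]
    (hC : Function.Bijective (LinearMap.lsmul R C)) :
    Function.Bijective (LinearMap.lsmul (Localization S) (LocalizedModule S C)) := by
  have := Module.finitePresentation_of_finite R C
  let e : R ≃ₗ[R] C →ₗ[R] C := LinearEquiv.ofBijective _ hC
  let L : Localization S →ₗ[R] LocalizedModule S C →ₗ[Localization S] LocalizedModule S C :=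
    (LinearMap.lsmul (Localization S) (LocalizedModule S C)).restrictScalars R
  have hL : L ∘ₗ Algebra.linearMap R (Localization S) =
      LocalizedModule.map S (M := C) (N := C) ∘ₗ e.toLinearMap := by
    ext x
    induction x using LocalizedModule.induction_on with
    | h m s => simp [L, e]
  have : IsLocalizedModule S (L ∘ₗ Algebra.linearMap R (Localization S)) := by
    rw [hL]
    infer_instance
  have hbij : Function.Bijective L := by
    rw [← IsLocalizedModule.linearEquiv_of_isLocalizedModule_comp S
      (Algebra.linearMap R (Localization S)) L]
    exact (IsLocalizedModule.linearEquiv ..).bijective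
  exact hbij

theorem IsSemidualizing.localizedModule (hC : IsSemidualizing R C) :
    IsSemidualizing (Localization S) (LocalizedModule S C) :=
  have := hC.finite
  { finite := inferInstance
    homothety := bijective_lsmul_localizedModule S hC.homothety
    ext_vanishing := fun i hi => ExtVanishes.localizedModule S hi (hC.ext_vanishing i hi) }

end Localization

section Syzygy

variable {R : Type u} [CommRing R]
variable {C M N P : Type u} [AddCommGroup C] [Module R C] [AddCommGroup M] [Module R M]
  [AddCommGroup N] [Module R N] [AddCommGroup P] [Module R P]

/-- The sequence `N, P 0, P 1, …`. -/
def consModule (N : ModuleCat.{u} R) (P : ℕ → ModuleCat.{u} R) : ℕ → ModuleCat.{u} R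
  | 0 => N
  | i + 1 => P i

/-- The sequence of maps `f, d 0, d 1, …` on `consModule N P`. -/
def consMap {N : ModuleCat.{u} R} {P : ℕ → ModuleCat.{u} R} (f : N →ₗ[R] P 0)
    (d : ∀ i, P i →ₗ[R] P (i + 1)) : ∀ i, consModule N P i →ₗ[R] consModule N P (i + 1)
  | 0 => f
  | i + 1 => d i

namespace IsCSyzygy

theorem zero : IsCSyzygy R C 0 M :=
  ⟨fun _ => ModuleCat.of R M, fun _ => 0, ⟨LinearEquiv.refl R M⟩, by omega, by omega, by omega⟩

theorem succ_of_exact {n : ℕ} {f : M →ₗ[R] P} {g : P →ₗ[R] N} (hf : Function.Injective f)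
    (hfg : Function.Exact f g) (hg : Function.Surjective g) (hP : IsSummandOfCopies R C P)
    (hN : IsCSyzygy R C n N) : IsCSyzygy R C (n + 1) M := by
  obtain ⟨Q, d, ⟨e⟩, hQ, hd₀, hd⟩ := hN
  refine ⟨consModule (ModuleCat.of R M) (consModule (ModuleCat.of R P) fun i => Q (i + 1)),
    consMap f (consMap (d 0 ∘ₗ e.toLinearMap ∘ₗ g) fun i => d (i + 1)),
    ⟨LinearEquiv.refl R M⟩, ?_, fun _ => hf, ?_⟩
  · rintro (_ | _ | i) hi hin
    · omega
    · exact hP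
    · exact hQ (i + 1) (by omega) (by omega)
  · rintro (_ | _ | i) hi
    · exact (Function.Injective.comp_exact_iff_exact
        (i := d 0 ∘ₗ e.toLinearMap) (by simpa using hd₀ (by omega))).mpr hfg
    · have hd₁ : Function.Exact (d 0 ∘ₗ e.toLinearMap ∘ₗ g) (d 1) :=
        (Function.Surjective.comp_exact_iff_exact (by simpa using hg)).mpr (hd 0 (by omega))
      exact hd₁
    · exact hd (i + 1) (by omega)

theorem exists_exact {n : ℕ} (h : IsCSyzygy R C (n + 1) M) :
    ∃ (P N : ModuleCat.{u} R) (f : M →ₗ[R] P) (g : P →ₗ[R] N), Function.Injective f ∧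
      Function.Exact f g ∧ Function.Surjective g ∧ IsSummandOfCopies R C P ∧
      IsCSyzygy R C n N := by
  obtain ⟨P, d, ⟨e⟩, hP, hd₀, hd⟩ := h
  let K := LinearMap.range (d 0)
  refine ⟨P 1, ModuleCat.of R (P 1 ⧸ K), d 0 ∘ₗ e.toLinearMap, K.mkQ,
    by simpa using hd₀ (by omega), ?_, K.mkQ_surjective, hP 1 le_rfl (by omega), ?_⟩
  · exact LinearEquiv.precomp_exact_iff_exact.mpr (d 0).exact_map_mkQ_range
  rcases n with _ | n
  · exact zero
  have hK : K = LinearMap.ker (d 1) := (LinearMap.exact_iff.mp (hd 0 (by omega))).symm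
  let f : (P 1 ⧸ K) →ₗ[R] P 2 := K.liftQ (d 1) hK.le
  refine ⟨consModule (ModuleCat.of R (P 1 ⧸ K)) fun i => P (i + 2),
    consMap f fun i => d (i + 2), ⟨LinearEquiv.refl R _⟩, ?_, fun _ => ?_, ?_⟩
  · rintro (_ | i) hi hin
    · omega
    · exact hP (i + 2) (by omega) (by omega)
  · exact LinearMap.ker_eq_bot.mp (Submodule.ker_liftQ_eq_bot' _ _ hK)
  · rintro (_ | i) hi
    · exact (Function.Surjective.comp_exact_iff_exact (f := f) K.mkQ_surjective).mp
        (hd 1 (by omega))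
    · exact hd (i + 2) (by omega)

end IsCSyzygy

theorem exists_isLeftApproximation [Module.Finite R (M →ₗ[R] C)] :
    ∃ (k : ℕ) (f : M →ₗ[R] (Fin k → C)), IsLeftApproximation C f := by
  obtain ⟨k, s, hs⟩ := Module.Finite.exists_fin (R := R) (M := M →ₗ[R] C)
  refine ⟨k, LinearMap.pi s, fun φ => ?_⟩
  obtain ⟨c, rfl⟩ := (Submodule.mem_span_range_iff_exists_fun R).mp
    (hs ▸ Submodule.mem_top : φ ∈ Submodule.span R (Set.range s))
  refine ⟨∑ j, c j • LinearMap.proj j, ?_⟩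
  ext x
  simp

end Syzygy

section CohenMacaulay

variable {R : Type u} [CommRing R]
variable {C M N P W : Type u} [AddCommGroup C] [Module R C] [AddCommGroup M] [Module R M]
  [AddCommGroup N] [Module R N] [AddCommGroup P] [Module R P] [AddCommGroup W] [Module R W]

/-- The depth of `M_𝔭` over `R_𝔭`. -/
noncomputable abbrev depthAt {R : Type u} [CommRing R] (M : Type u) [AddCommGroup M] [Module R M]
    (p : PrimeSpectrum R) : ℕ∞ :=
  localDepth (Localization.AtPrime p.asIdeal) (LocalizedModule p.asIdeal.primeCompl M)

theorem satisfiesSerre_iff {n : ℕ} :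
    SatisfiesSerre R n M ↔ ∀ p : PrimeSpectrum R, min (n : ℕ∞) p.asIdeal.height ≤ depthAt M p := by
  refine forall_congr' fun p => ?_
  rw [IsLocalization.AtPrime.ringKrullDim_eq_height p.asIdeal]
  norm_cast

theorem SatisfiesSerre.mono {m n : ℕ} (hM : SatisfiesSerre R n M) (hmn : m ≤ n) :
    SatisfiesSerre R m M :=
  satisfiesSerre_iff.mpr fun p => (min_le_min_right _ (by exact_mod_cast hmn)).trans
    (satisfiesSerre_iff.mp hM p)

theorem SatisfiesG.mono {k l : ℤ} (hG : SatisfiesG R C l) (hkl : k ≤ l) : SatisfiesG R C k :=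
  fun p h hp hh => hG p h hp (hh.trans hkl)

theorem IsCohenMacaulayRing.localDepth_eq (hR : IsCohenMacaulayRing R) (p : PrimeSpectrum R) :
    localDepth (Localization.AtPrime p.asIdeal) (Localization.AtPrime p.asIdeal) =
      p.asIdeal.height :=
  WithBot.coe_injective <|
    (hR p).trans (IsLocalization.AtPrime.ringKrullDim_eq_height p.asIdeal _)

/-- Gorenstein modules of full support in the sense of Sharp: finitely generated modules that are
locally maximal Cohen–Macaulay and of finite injective dimension. As `depth 0 = ∞`, the condition
on the depth forces `W_𝔭 ≠ 0` for all `𝔭`. A canonical module is a Gorenstein module of type one. -/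
structure IsGorensteinModule (R : Type u) [CommRing R] (W : Type u) [AddCommGroup W] [Module R W] :
    Prop where
  finite : Module.Finite R W
  maximalCohenMacaulay : ∀ p : PrimeSpectrum R,
    (depthAt W p : WithBot ℕ∞) = ringKrullDim (Localization.AtPrime p.asIdeal)
  finiteInjDim : ∀ p : PrimeSpectrum R,
    HasFiniteInjDim (Localization.AtPrime p.asIdeal) (LocalizedModule p.asIdeal.primeCompl W)

theorem IsCanonicalModule.isGorensteinModule (hW : IsCanonicalModule R W) :
    IsGorensteinModule R W where
  finite := hW.finite
  maximalCohenMacaulay p := (hW.localCanonical p).maximalCohenMacaulay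
  finiteInjDim p := (hW.localCanonical p).finiteInjDim

theorem IsGorensteinModule.satisfiesSerre (hW : IsGorensteinModule R W) (n : ℕ) :
    SatisfiesSerre R n W :=
  fun p => (min_le_right _ _).trans (hW.maximalCohenMacaulay p).ge

theorem hasFiniteInjDim_localizedModule_self_iff (S : Submonoid R) :
    HasFiniteInjDim (Localization S) (LocalizedModule S R) ↔
      IsGorensteinLocal (Localization S) := by
  let e : LocalizedModule S R ≃ₗ[Localization S] Localization S :=
    LinearEquiv.extendScalarsOfIsLocalization S (Localization S)
      (IsLocalizedModule.linearEquiv S (LocalizedModule.mkLinearMap S R)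
        (Algebra.linearMap R (Localization S)))
  exact ⟨fun h => h.of_retract e.comp_symm, fun h => h.of_retract e.symm_comp⟩

variable [IsNoetherianRing R]

theorem IsSemidualizing.height_le_depthAt (hC : IsSemidualizing R C) (hR : IsCohenMacaulayRing R)
    (hP : IsSummandOfCopies R C P) (p : PrimeSpectrum R) : p.asIdeal.height ≤ depthAt P p := by
  have := hC.finite
  calc p.asIdeal.height
    _ = localDepth (Localization.AtPrime p.asIdeal) (Localization.AtPrime p.asIdeal) :=
      (hR.localDepth_eq p).symm
    _ ≤ depthAt C p := (hC.localizedModule _).localDepth_self_le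
    _ ≤ depthAt P p := (hP.localizedModule _).localDepth_le

theorem IsCSyzygy.satisfiesSerre (hR : IsCohenMacaulayRing R) (hC : IsSemidualizing R C) {n : ℕ}
    [Module.Finite R M] (hM : IsCSyzygy R C n M) : SatisfiesSerre R n M := by
  rw [satisfiesSerre_iff]
  intro p
  induction n generalizing M with
  | zero => simp
  | succ n ih =>
    have := hC.finite
    obtain ⟨P, N, f, g, hf, hfg, hg, hP, hN⟩ := hM.exists_exact
    have := hP.finite
    have : Module.Finite R N := .of_surjective g hg
    have hN' : min ((n + 1 : ℕ) : ℕ∞) p.asIdeal.height ≤ depthAt N p + 1 := by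
      calc min ((n + 1 : ℕ) : ℕ∞) p.asIdeal.height
        _ ≤ min ((n + 1 : ℕ) : ℕ∞) (p.asIdeal.height + 1) := min_le_min_left _ le_self_add
        _ = min (n : ℕ∞) p.asIdeal.height + 1 := by rw [Nat.cast_add_one, min_add_add_right]
        _ ≤ depthAt N p + 1 := by gcongr; exact ih hN
    exact (le_min ((min_le_right _ _).trans (hC.height_le_depthAt hR hP p)) hN').trans <|
      min_localDepth_le_localDepth_left (LocalizedModule.map_injective _ f hf)
        (exact_localizedModule_map _ hfg) (LocalizedModule.map_surjective _ g hg)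

theorem depthAt_eq_zero_of_mem_associatedPrimes [Module.Finite R M] {p : PrimeSpectrum R}
    (hp : p.asIdeal ∈ associatedPrimes R M) : depthAt M p = 0 := by
  rw [localDepth_eq_zero_iff_exists_injective]
  exact ((isAssociatedPrime_iff_exists_injective_linearMap _ _).mp
    (Module.associatedPrimes.mem_associatedPrimes_atPrime_of_mem_associatedPrimes hp)).2

theorem SatisfiesSerre.height_eq_zero [Module.Finite R M] (hM : SatisfiesSerre R 1 M)
    {p : PrimeSpectrum R} (hp : p.asIdeal ∈ associatedPrimes R M) : p.asIdeal.height = 0 := by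
  have h := satisfiesSerre_iff.mp hM p
  rw [depthAt_eq_zero_of_mem_associatedPrimes hp] at h
  simpa using h

theorem IsLeftApproximation.injective (hR : IsCohenMacaulayRing R) (hC : IsSemidualizing R C)
    (hG : SatisfiesG R C 0) [Module.Finite R M] (hM : SatisfiesSerre R 1 M) {f : M →ₗ[R] P}
    (hf : IsLeftApproximation C f) : Function.Injective f := by
  have := hC.finite
  have := Module.finitePresentation_of_finite R M
  rw [← LinearMap.ker_eq_bot]
  by_contra hK
  have : Nontrivial (LinearMap.ker f) := Submodule.nontrivial_iff_ne_bot.mpr hK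
  obtain ⟨p, hpK⟩ : ∃ p : PrimeSpectrum R, p.asIdeal ∈ associatedPrimes R (LinearMap.ker f) :=
    let ⟨I, hI⟩ := associatedPrimes.nonempty R (LinearMap.ker f)
    ⟨⟨I, IsAssociatedPrime.isPrime hI⟩, hI⟩
  let ι := (LinearMap.ker f).subtype
  have hι : Function.Injective ι := Subtype.val_injective
  have hp : p.asIdeal.height = 0 :=
    hM.height_eq_zero (IsAssociatedPrime.map_of_injective ι hpK hι)
  have hCp := hC.localizedModule p.asIdeal.primeCompl
  have := hCp.nontrivial
  refine (hG p 0 hp le_rfl).localDepth_ne_zero_of_comp_eq_zero ((hR.localDepth_eq p).trans hp)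
    (LocalizedModule.map_injective _ ι hι) ?_ (hf.localizedModule _)
    (depthAt_eq_zero_of_mem_associatedPrimes hpK)
  rw [← localizedModule_map_comp, LinearMap.comp_ker_subtype, map_zero]

theorem SatisfiesSerre.of_isLeftApproximation (hR : IsCohenMacaulayRing R)
    (hC : IsSemidualizing R C) {n : ℕ} (hG : SatisfiesG R C n) [Module.Finite R M]
    (hM : SatisfiesSerre R (n + 1) M) (hP : IsSummandOfCopies R C P) {f : M →ₗ[R] P}
    {g : P →ₗ[R] N} (hf : Function.Injective f) (hfg : Function.Exact f g)
    (hg : Function.Surjective g) (hfC : IsLeftApproximation C f) : SatisfiesSerre R n N := by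
  have := hC.finite
  have := hP.finite
  have : Module.Finite R N := .of_surjective g hg
  have := Module.finitePresentation_of_finite R M
  refine satisfiesSerre_iff.mpr fun p => ?_
  have hMp := satisfiesSerre_iff.mp hM p
  have hf' := LocalizedModule.map_injective p.asIdeal.primeCompl f hf
  have hfg' := exact_localizedModule_map p.asIdeal.primeCompl hfg
  have hg' := LocalizedModule.map_surjective p.asIdeal.primeCompl g hg
  obtain ⟨h, hh⟩ := ENat.ne_top_iff_exists.mp (Ideal.height_ne_top p.isPrime.ne_top)
  rcases le_or_gt h n with hhn | hnh
  · have hdepth : localDepth (Localization.AtPrime p.asIdeal) (Localization.AtPrime p.asIdeal) ≤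
        depthAt M p := by
      rw [hR.localDepth_eq p, ← hh]
      rwa [← hh, min_eq_right (by exact_mod_cast hhn.trans n.le_succ)] at hMp
    have hN := (hG p h hh.symm (by exact_mod_cast hhn)).localDepth_self_le_of_exact
      (hC.localizedModule _) hf' hfg' hg' (hfC.localizedModule _) (hP.localizedModule _) hdepth
    exact (min_le_right _ _).trans ((hR.localDepth_eq p).ge.trans hN)
  · have hnp : ((n + 1 : ℕ) : ℕ∞) ≤ p.asIdeal.height := hh ▸ by exact_mod_cast hnh
    rw [min_eq_left hnp] at hMp
    have hN : ((n + 1 : ℕ) : ℕ∞) ≤ depthAt N p + 1 :=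
      (le_min hMp (hnp.trans ((hC.height_le_depthAt hR hP p).trans le_self_add))).trans <|
        min_localDepth_le_localDepth_right hf' hfg' hg'
    rw [Nat.cast_add_one, ENat.add_le_add_iff_right ENat.one_ne_top] at hN
    exact (min_le_left _ _).trans hN

theorem SatisfiesSerre.isCSyzygy (hR : IsCohenMacaulayRing R) (hC : IsSemidualizing R C) {n : ℕ}
    (hG : SatisfiesG R C ((n : ℤ) - 1)) [Module.Finite R M] (hM : SatisfiesSerre R n M) :
    IsCSyzygy R C n M := by
  have := hC.finite
  induction n generalizing M with
  | zero => exact .zero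
  | succ n ih =>
    have hGn : SatisfiesG R C n := by simpa using hG
    obtain ⟨k, f, hf⟩ := exists_isLeftApproximation (R := R) (M := M) (C := C)
    have hinj : Function.Injective f :=
      hf.injective hR hC (hGn.mono (by omega)) (hM.mono (by omega))
    have hexact : Function.Exact f (LinearMap.range f).mkQ := f.exact_map_mkQ_range
    have hsurj : Function.Surjective (LinearMap.range f).mkQ := Submodule.mkQ_surjective _
    have hP : IsSummandOfCopies R C (Fin k → C) := .pi k
    exact .succ_of_exact hinj hexact hsurj hP <| ih (hGn.mono (by omega)) <|
      .of_isLeftApproximation hR hC hGn hM hP hinj hexact hsurj hf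

namespace IsGorensteinModule

theorem nontrivial (hW : IsGorensteinModule R W) (p : PrimeSpectrum R) :
    Nontrivial (LocalizedModule p.asIdeal.primeCompl W) := by
  rw [← not_subsingleton_iff_nontrivial]
  intro
  have h := hW.maximalCohenMacaulay p
  rw [depthAt, localDepth_eq_top] at h
  exact ringKrullDim_ne_top h.symm

theorem isCohenMacaulayRing (hW : IsGorensteinModule R W) : IsCohenMacaulayRing R := by
  intro p
  have := hW.finite
  have := hW.nontrivial p
  refine localDepth_self_le_ringKrullDim.antisymm ?_
  rw [← hW.maximalCohenMacaulay p]
  exact WithBot.coe_le_coe.mpr (hW.finiteInjDim p).localDepth_le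

theorem satisfiesG (hW : IsGorensteinModule R W) (hC : IsSemidualizing R C) {n : ℕ}
    (hsyz : IsCSyzygy R C n W) : SatisfiesG R C ((n : ℤ) - 1) := by
  intro p h hh hhn
  obtain ⟨n, rfl⟩ := Nat.exists_eq_succ_of_ne_zero (by omega : n ≠ 0)
  have hR := hW.isCohenMacaulayRing
  have := hC.finite
  have := hW.finite
  have := hW.nontrivial p
  obtain ⟨P, N, f, g, hf, hfg, hg, hP, hN⟩ := hsyz.exists_exact
  have := hP.finite
  have : Module.Finite R N := .of_surjective g hg
  have hdepth : localDepth (Localization.AtPrime p.asIdeal) (Localization.AtPrime p.asIdeal) ≤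
      depthAt N p := by
    have hNp := satisfiesSerre_iff.mp (hN.satisfiesSerre hR hC) p
    rwa [hh, min_eq_right (by exact_mod_cast (by omega : h ≤ n)), ← hh, ← hR.localDepth_eq p]
      at hNp
  exact .of_exact (hC.localizedModule _).homothety.2 (hW.finiteInjDim p)
    (LocalizedModule.map_injective _ f hf) (exact_localizedModule_map _ hfg)
    (LocalizedModule.map_surjective _ g hg) (hP.localizedModule _) hdepth

end IsGorensteinModule

theorem satisfiesG_self_iff (n : ℕ) : SatisfiesG R R ((n : ℤ) - 1) ↔
    ∀ p : PrimeSpectrum R, p.asIdeal.height < n →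
      IsGorensteinLocal (Localization.AtPrime p.asIdeal) := by
  simp only [SatisfiesG, hasFiniteInjDim_localizedModule_self_iff]
  refine forall_congr' fun p => ?_
  obtain ⟨h, hh⟩ := ENat.ne_top_iff_exists.mp (Ideal.height_ne_top p.isPrime.ne_top)
  simp [← hh]

end CohenMacaulay

theorem theorem4p1_general {R : Type u} [CommRing R] [IsNoetherianRing R] {C W : Type u}
    [AddCommGroup C] [Module R C] [AddCommGroup W] [Module R W] (hW : IsGorensteinModule R W)
    (hC : IsSemidualizing R C) (n : ℕ) :
    [SatisfiesG R C ((n : ℤ) - 1),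
      serreClass R n = cSyzygyClass R C n,
      ModuleCat.of R W ∈ cSyzygyClass R C n].TFAE := by
  have hR := hW.isCohenMacaulayRing
  tfae_have 1 → 2 := fun hG => by
    ext M
    exact and_congr_right fun _ =>
      ⟨fun hM => hM.isCSyzygy hR hC hG, fun hM => hM.satisfiesSerre hR hC⟩
  tfae_have 2 → 3 := fun h => h ▸ ⟨hW.finite, hW.satisfiesSerre n⟩
  tfae_have 3 → 1 := fun h => hW.satisfiesG hC h.2
  tfae_finish

theorem theorem4p1 (R : Type u) [CommRing R] [IsNoetherianRing R] (hR : IsCohenMacaulayRing R)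
    (W : Type u) [AddCommGroup W] [Module R W] (hW : IsCanonicalModule R W) (n : ℕ) :
    (∀ (C : Type u) [AddCommGroup C] [Module R C], IsSemidualizing R C →
      [SatisfiesG R C ((n : ℤ) - 1),
        serreClass R n = cSyzygyClass R C n,
        ModuleCat.of R W ∈ cSyzygyClass R C n].TFAE) ∧
    [∀ p : PrimeSpectrum R, p.asIdeal.height < n →
        IsGorensteinLocal (Localization.AtPrime p.asIdeal),
      serreClass R n = cSyzygyClass R R n,
      ModuleCat.of R W ∈ cSyzygyClass R R n].TFAE := by
  refine ⟨fun _ _ _ hC => theorem4p1_general hW.isGorensteinModule hC n, ?_⟩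
  simpa only [satisfiesG_self_iff] using
    theorem4p1_general hW.isGorensteinModule isSemidualizing_self n
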